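/- **Theorem 3.2.** Notation. For a positive definite $n\times n$ matrix $C$ and $\frac{n}{n+2}<p<1$ put $\beta_{n,p}=\frac{1}{2p-n(1-p)}$ and let $$g_{p,C}(x)=A_p\big(1+(1-p)\beta_{n,p}\,x^TC^{-1}x\big)^{\frac1{p-1}},\qquad A_p=\frac{\Gamma(\frac1{1-p})\,(\beta_{n,p}(1-p))^{n/2}}{\Gamma(\frac1{1-p}-\frac n2)\,\pi^{n/2}(\det C)^{1/2}},\qquad x\in\mathbb R^n .$$ For $q>(1-p)n/2$ let $$\varpi^*_n(p,q)=\frac{\Gamma(\frac1{1-p})^q\,(\beta_{n,p}(1-p))^{n(q-1)/2}\,\Gamma(\frac q{1-p}-\frac n2)}{\Gamma(\frac1{1-p}-\frac n2)^q\,\pi^{n(q-1)/2}\,\Gamma(\frac q{1-p})},\qquad \varpi^*_n(p)=\varpi^*_n(p,p),$$ and, for measurable $\varphi:\mathbb R^n\to[0,\infty)$, let $$\alpha^{*}_{\varphi,p}(C)=\mathbb E\Big[\varphi\Big(\big\{2\big(\tfrac p{1-p}-\tfrac n2\big)\big\}^{1/2}C^{1/2}Y^*\Big)\Big],$$ where $Y^*$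 has the Pearson type VII density $\frac{\Gamma(\mu)}{\pi^{n/2}\Gamma(\mu-n/2)}(1+y^Ty)^{-\mu}$ on $\mathbb R^n$ with $\mu=\frac q{1-p}$; throughout the theorem $q=p'$. Statement. Let $n=n_1+n_2$, $n'=n_1'+n_2'$, let $B=(B_{ij})_{i,j=1,2}$ be a real block matrix with $B_{ij}$ of size $n'_i\times n_j$, and let $C=(C_{ij})_{i,j=1,2}$ be a positive definite block matrix with $C_{ij}$ of size $n_i\times n_j$, such that $C'=BCB^T$ is positive definite (that is, $B$ has full row rank). Let $C'_1,C'_2$ be the diagonal blocks of $C'$, of sizes $n'_1\times n'_1$ and $n'_2\times n'_2$. Let $$p'\in\Big(\frac{n'}{n'+2},1\Big),\qquad p'_i\in\Big(\frac{n'_i}{n'_i+2},1\Big),\qquad p'>\frac{(1-p'_i)n'_i}{2},\qquad i=1,2.$$ (No further relation between the exponents is needed. In particular they may be linked by $\frac1{1-p'_i}=\frac1{1-p'}-\frac{n'_i}2$, or by $\frac1{1-p'_i}=\frac1{1-p'}-\frac{n'-n'_i}2$, in which case $g_{p'_i,C'_i}$ are the marginals of $g_{p',C'}$.) Let $\varphi_i:\mathbb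 R^{n'_i}\to[0,\infty)$ be measurable, $\varphi(x)=\varphi_1(x_1)\varphi_2(x_2)$ for $x=(x_1,x_2)\in\mathbb R^{n'}$, and suppose that $\alpha^*_{\varphi_1,p'_1}(C'_1)$ and $\alpha^*_{\varphi_2,p'_2}(C'_2)$ are finite and non-zero. If $$\int_{\mathbb R^{n'}}\ \prod_{j=1,2}\varphi_j(x_j)\,g_{p'_j,C'_j}(x_j)^{p'-1}\Big[g_{p',C'}(x)-\prod_{j=1,2}g_{p'_j,C'_j}(x_j)\Big]\,dx\ \le 0,$$ where the integrand is assumed integrable, then $\alpha^*_{\varphi,p'}(C')$ is finite and $$\bigg(\frac{\det BCB^T}{\det C'_1\,\det C'_2}\bigg)^{1-p'}\bigg(\frac{\alpha^*_{\varphi,p'}(BCB^T)}{\alpha^*_{\varphi_1,p'_1}(C'_1)\,\alpha^*_{\varphi_2,p'_2}(C'_2)}\bigg)^2\le \zeta(p',p'_1,p'_2):=\frac{\varpi^*_{n'_1}(p'_1,p')\,\varpi^*_{n'_2}(p'_2,p')}{\varpi^*_{n'}(p')}.$$ -/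

import Mathlib

open MeasureTheory

noncomputable section

/-- The constant `β = 1 / (2p - n(1 - p))`. -/
def renyiBeta (n : ℕ) (p : ℝ) : ℝ :=
  1 / (2 * p - n * (1 - p))

/-- The normalising constant `A_p` of `renyiDensity`, in the range `n / (n + 2) < p < 1`. -/
def renyiA {ι : Type*} [Fintype ι] [DecidableEq ι] (p : ℝ) (C : Matrix ι ι ℝ) : ℝ :=
  (Real.Gamma (1 / (1 - p)) *
      (renyiBeta (Fintype.card ι) p * (1 - p)) ^ ((Fintype.card ι : ℝ) / 2)) /
    (Real.Gamma (1 / (1 - p) - (Fintype.card ι : ℝ) / 2) *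
      Real.pi ^ ((Fintype.card ι : ℝ) / 2) * C.det ^ ((1 : ℝ) / 2))

/-- The Rényi entropy maximising density (multivariate Student-t)
`g_{p,C}(x) = A_p (1 + (1 - p) β xᵀ C⁻¹ x) ^ (1 / (p - 1))` on `ℝⁿ`, for `C` positive definite and
`n / (n + 2) < p < 1`; the base is then at least `1`, so no positive part is needed. -/
def renyiDensity {ι : Type*} [Fintype ι] [DecidableEq ι] (p : ℝ) (C : Matrix ι ι ℝ)
    (x : ι → ℝ) : ℝ :=
  renyiA p C *
    (1 + (1 - p) * renyiBeta (Fintype.card ι) p * (x ⬝ᵥ (C⁻¹.mulVec x))) ^ (1 / (p - 1))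

/-- Pearson's type VII density `f_VII(x; μ)` on `ℝⁿ`, for `μ > n / 2`. -/
def pearsonVII {ι : Type*} [Fintype ι] (μ : ℝ) (x : ι → ℝ) : ℝ :=
  Real.Gamma μ /
      (Real.pi ^ ((Fintype.card ι : ℝ) / 2) * Real.Gamma (μ - (Fintype.card ι : ℝ) / 2)) *
    (1 + x ⬝ᵥ x) ^ (-μ)

/-- The constant `ϖ*_n(p, q)`, for `n / (n + 2) < p < 1` and `q > (1 - p) n / 2`. -/
def varpiStar (n : ℕ) (p q : ℝ) : ℝ :=
  (Real.Gamma (1 / (1 - p)) ^ q * (renyiBeta n p * (1 - p)) ^ ((n : ℝ) * (q - 1) / 2) *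
      Real.Gamma (q / (1 - p) - (n : ℝ) / 2)) /
    (Real.Gamma (1 / (1 - p) - (n : ℝ) / 2) ^ q * Real.pi ^ ((n : ℝ) * (q - 1) / 2) *
      Real.Gamma (q / (1 - p)))

/-- The rescaled weight `ρ*(y) = φ({2 (p / (1 - p) - n / 2)}^{1/2} C^{1/2} y)`, where `C^{1/2}` is
the positive semidefinite square root, given by the functional calculus. -/
def rhoStar {ι : Type*} [Fintype ι] [DecidableEq ι] (φ : (ι → ℝ) → ℝ) (p : ℝ)
    (C : Matrix ι ι ℝ) (y : ι → ℝ) : ℝ :=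
  φ (Real.sqrt (2 * (p / (1 - p) - (Fintype.card ι : ℝ) / 2)) •
    ((cfc Real.sqrt C).mulVec y))

/-- `ρ*` times the density of `Y* ∼ f_VII(· ; q / (1 - p))`. -/
def alphaStarIntegrand {ι : Type*} [Fintype ι] [DecidableEq ι] (φ : (ι → ℝ) → ℝ) (p q : ℝ)
    (C : Matrix ι ι ℝ) (y : ι → ℝ) : ℝ :=
  rhoStar φ p C y * pearsonVII (q / (1 - p)) y

/-- The expectation `α*_{φ,p}(C) = E[ρ*(Y*)]` with `Y* ∼ f_VII(· ; q / (1 - p))`. -/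
def alphaStar {ι : Type*} [Fintype ι] [DecidableEq ι] (φ : (ι → ℝ) → ℝ) (p q : ℝ)
    (C : Matrix ι ι ℝ) : ℝ :=
  ∫ y : ι → ℝ, alphaStarIntegrand φ p q C y

/-- The product weight `φ(x₁, x₂) = φ₁(x₁) φ₂(x₂)`. -/
def prodWeight {ι κ : Type*} (φ₁ : (ι → ℝ) → ℝ) (φ₂ : (κ → ℝ) → ℝ) (x : ι ⊕ κ → ℝ) : ℝ :=
  φ₁ (fun i => x (Sum.inl i)) * φ₂ (fun k => x (Sum.inr k))

/-- The product `g_{p₁,C₁}(x₁) g_{p₂,C₂}(x₂)`, where `C₁`, `C₂` are the diagonal blocks of `D`. -/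
def blockProductDensity {ι κ : Type*} [Fintype ι] [DecidableEq ι] [Fintype κ] [DecidableEq κ]
    (p₁ p₂ : ℝ) (D : Matrix (ι ⊕ κ) (ι ⊕ κ) ℝ) (x : ι ⊕ κ → ℝ) : ℝ :=
  renyiDensity p₁ D.toBlocks₁₁ (fun i => x (Sum.inl i)) *
    renyiDensity p₂ D.toBlocks₂₂ (fun k => x (Sum.inr k))

/-- The integrand
`∏ⱼ φⱼ(xⱼ) g_{pⱼ,Dⱼ}(xⱼ) ^ (p - 1) · [g_{p,D}(x) - ∏ⱼ g_{pⱼ,Dⱼ}(xⱼ)]` of the weight condition,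
where `D₁`, `D₂` are the diagonal blocks of `D`. -/
def conditionIntegrand {ι κ : Type*} [Fintype ι] [DecidableEq ι] [Fintype κ] [DecidableEq κ]
    (φ₁ : (ι → ℝ) → ℝ) (φ₂ : (κ → ℝ) → ℝ) (p p₁ p₂ : ℝ)
    (D : Matrix (ι ⊕ κ) (ι ⊕ κ) ℝ) (x : ι ⊕ κ → ℝ) : ℝ :=
  (φ₁ (fun i => x (Sum.inl i)) *
      renyiDensity p₁ D.toBlocks₁₁ (fun i => x (Sum.inl i)) ^ (p - 1)) *
    (φ₂ (fun k => x (Sum.inr k)) *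
      renyiDensity p₂ D.toBlocks₂₂ (fun k => x (Sum.inr k)) ^ (p - 1)) *
    (renyiDensity p D x - blockProductDensity p₁ p₂ D x)

/-- The constant `ζ(p, p₁, p₂) = ϖ*_{m₁}(p₁, p) ϖ*_{m₂}(p₂, p) / ϖ*_{m₁+m₂}(p, p)`. -/
def zetaConst (m₁ m₂ : ℕ) (p p₁ p₂ : ℝ) : ℝ :=
  varpiStar m₁ p₁ p * varpiStar m₂ p₂ p / varpiStar (m₁ + m₂) p p

end

/-! ### Normalisation and second moment of the Pearson VII density. -/

section PearsonIntegral

variable {ι : Type*} [Fintype ι]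

/-! Write `D = BCBᵀ`, let `G` be the density `g_{p,D}` and `F` the product of the two block
densities. Since `t ↦ t ^ p` is concave for `0 < p < 1`, it lies below its tangent at `F`: `G^p ≤
F^p + p F^(p-1) (G - F)`. Integrating against `φ = φ₁φ₂`, the weight condition makes the last term
nonpositive, so `∫ φ G^p ≤ ∫ φ F^p`, and the right side factors over the blocks
(`integrable_and_integral_mul_rpow_le`).

The substitution `x = s D^{1/2} y` evaluates every such integral as `ϖ* (det D)^((1-p)/2) α*`
(`integral_mul_renyiDensity_rpow`). The inequality becomes `X ≤ ζ`, where `X²` is the left side of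
the theorem.

It remains to see `ζ ≤ 1`, for then `X² ≤ ζ² ≤ ζ`. This is the maximum entropy property
(`varpiStar_mul_varpiStar_le`): the same tangent inequality with weight `1`, identity matrices and
the roles of `F` and `G` exchanged. Now `G^(p-1)` is affine in `xᵀx`, and the two densities have
equal mass and equal second moment, so the correction term integrates to zero. -/

theorem zero_le_dotProduct_self (x : ι → ℝ) : 0 ≤ x ⬝ᵥ x :=
  Finset.sum_nonneg fun _ _ => mul_self_nonneg _

theorem integral_exp_neg_mul_dotProduct_self {t : ℝ} (ht : 0 < t) :
    ∫ x : ι → ℝ, Real.exp (-t * (x ⬝ᵥ x)) = (Real.pi / t) ^ ((Fintype.card ι : ℝ) / 2) := by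
  have h (x : ι → ℝ) : Real.exp (-t * (x ⬝ᵥ x)) = ∏ i, Real.exp (-t * x i ^ 2) := by
    rw [← Real.exp_sum, dotProduct, Finset.mul_sum]
    simp only [pow_two]
  simp_rw [h]
  rw [integral_fintype_prod_volume_eq_pow (fun y : ℝ => Real.exp (-t * y ^ 2)), integral_gaussian,
    Real.sqrt_eq_rpow, ← Real.rpow_natCast, ← Real.rpow_mul (by positivity)]
  congr 1
  ring

theorem lintegral_exp_neg_mul_dotProduct_self {t : ℝ} (ht : 0 < t) :
    ∫⁻ x : ι → ℝ, ENNReal.ofReal (Real.exp (-t * (x ⬝ᵥ x))) =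
      ENNReal.ofReal ((Real.pi / t) ^ ((Fintype.card ι : ℝ) / 2)) := by
  have h := integral_exp_neg_mul_dotProduct_self (ι := ι) ht
  rw [← h, ofReal_integral_eq_lintegral_ofReal _ (ae_of_all _ fun _ => (Real.exp_pos _).le)]
  -- A Bochner integral with nonzero value certifies integrability, as nonintegrable functions have
  -- integral `0`.
  refine Integrable.of_integral_ne_zero ?_
  rw [h]
  have := Real.pi_pos
  positivity

theorem lintegral_rpow_mul_exp_neg_mul_Ioi {a r : ℝ} (ha : 0 < a) (hr : 0 < r) :
    ∫⁻ t in Set.Ioi (0 : ℝ), ENNReal.ofReal (t ^ (a - 1) * Real.exp (-(r * t))) =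
      ENNReal.ofReal ((1 / r) ^ a * Real.Gamma a) := by
  have h := Real.integral_rpow_mul_exp_neg_mul_Ioi ha hr
  rw [← h, ofReal_integral_eq_lintegral_ofReal]
  · refine Integrable.of_integral_ne_zero ?_
    rw [h]
    have := Real.Gamma_pos_of_pos ha
    positivity
  · filter_upwards [ae_restrict_mem measurableSet_Ioi] with t (ht : 0 < t)
    exact mul_nonneg (Real.rpow_nonneg ht.le _) (Real.exp_pos _).le

/-- The Gamma integral writes the power as a mixture of Gaussians in `x`; Tonelli then leaves a
Gaussian integral inside and a Gamma integral with parameter `μ - n/2` outside. Lower integrals make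
the exchange free of integrability conditions. -/
theorem lintegral_one_add_dotProduct_self_rpow_neg {μ : ℝ} (hμ : (Fintype.card ι : ℝ) / 2 < μ) :
    ∫⁻ x : ι → ℝ, ENNReal.ofReal ((1 + x ⬝ᵥ x) ^ (-μ) * Real.Gamma μ) =
      ENNReal.ofReal (Real.pi ^ ((Fintype.card ι : ℝ) / 2) *
        Real.Gamma (μ - (Fintype.card ι : ℝ) / 2)) := by
  have hμ0 : 0 < μ := lt_of_le_of_lt (by positivity) hμ
  have key (x : ι → ℝ) : ENNReal.ofReal ((1 + x ⬝ᵥ x) ^ (-μ) * Real.Gamma μ) =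
      ∫⁻ t in Set.Ioi (0 : ℝ), ENNReal.ofReal (t ^ (μ - 1) * Real.exp (-((1 + x ⬝ᵥ x) * t))) := by
    have hx := zero_le_dotProduct_self x
    rw [lintegral_rpow_mul_exp_neg_mul_Ioi hμ0 (by positivity), Real.rpow_neg (by positivity),
      one_div, Real.inv_rpow (by positivity)]
  simp_rw [key]
  rw [lintegral_lintegral_swap]
  · have hG := lintegral_rpow_mul_exp_neg_mul_Ioi
      (a := μ - (Fintype.card ι : ℝ) / 2) (by linarith) one_pos
    rw [one_div_one, Real.one_rpow, one_mul] at hG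
    rw [ENNReal.ofReal_mul (by positivity), ← hG,
      ← lintegral_const_mul' _ _ ENNReal.ofReal_ne_top]
    refine setLIntegral_congr_fun measurableSet_Ioi fun t (ht : 0 < t) => ?_
    have h (x : ι → ℝ) : ENNReal.ofReal (t ^ (μ - 1) * Real.exp (-((1 + x ⬝ᵥ x) * t))) =
        ENNReal.ofReal (t ^ (μ - 1) * Real.exp (-t)) *
          ENNReal.ofReal (Real.exp (-t * (x ⬝ᵥ x))) := by
      rw [← ENNReal.ofReal_mul (by positivity), mul_assoc, ← Real.exp_add]
      ring_nf
    simp_rw [h]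
    rw [lintegral_const_mul' _ _ ENNReal.ofReal_ne_top, lintegral_exp_neg_mul_dotProduct_self ht,
      ← ENNReal.ofReal_mul (by positivity), ← ENNReal.ofReal_mul (by positivity)]
    congr 1
    rw [Real.div_rpow Real.pi_pos.le ht.le,
      show μ - (Fintype.card ι : ℝ) / 2 - 1 = μ - 1 - (Fintype.card ι : ℝ) / 2 by ring,
      Real.rpow_sub ht (μ - 1)]
    ring_nf
  · refine Measurable.aemeasurable ?_
    unfold Function.uncurry dotProduct
    fun_prop

theorem integral_one_add_dotProduct_self_rpow_neg {μ : ℝ} (hμ : (Fintype.card ι : ℝ) / 2 < μ) :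
    ∫ x : ι → ℝ, (1 + x ⬝ᵥ x) ^ (-μ) =
      Real.pi ^ ((Fintype.card ι : ℝ) / 2) * Real.Gamma (μ - (Fintype.card ι : ℝ) / 2) /
        Real.Gamma μ := by
  have hμ0 : 0 < μ := lt_of_le_of_lt (by positivity) hμ
  have hΓ := Real.Gamma_pos_of_pos hμ0
  have hΓ' : 0 < Real.Gamma (μ - (Fintype.card ι : ℝ) / 2) :=
    Real.Gamma_pos_of_pos (by linarith)
  have hπ := Real.pi_pos
  rw [eq_div_iff hΓ.ne', ← integral_mul_const, integral_eq_lintegral_of_nonneg_ae,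
    lintegral_one_add_dotProduct_self_rpow_neg hμ, ENNReal.toReal_ofReal (by positivity)]
  · refine ae_of_all _ fun x => ?_
    have hx := zero_le_dotProduct_self x
    simp only [Pi.zero_apply]
    positivity
  · refine Measurable.aestronglyMeasurable ?_
    unfold dotProduct
    fun_prop

theorem integral_pearsonVII {μ : ℝ} (hμ : (Fintype.card ι : ℝ) / 2 < μ) :
    ∫ x : ι → ℝ, pearsonVII μ x = 1 := by
  have hμ0 : 0 < μ := lt_of_le_of_lt (by positivity) hμ
  have hΓ := Real.Gamma_pos_of_pos hμ0
  have hΓ' : 0 < Real.Gamma (μ - (Fintype.card ι : ℝ) / 2) :=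
    Real.Gamma_pos_of_pos (by linarith)
  have hπ := Real.pi_pos
  unfold pearsonVII
  rw [integral_const_mul, integral_one_add_dotProduct_self_rpow_neg hμ, div_mul_div_comm,
    mul_comm (Real.Gamma μ), div_self (by positivity)]

theorem integrable_pearsonVII {μ : ℝ} (hμ : (Fintype.card ι : ℝ) / 2 < μ) :
    Integrable (pearsonVII μ : (ι → ℝ) → ℝ) :=
  .of_integral_ne_zero (by rw [integral_pearsonVII hμ]; exact one_ne_zero)

/-- Multiplying the Pearson VII density by `1 + xᵀ x` gives a multiple of the density with
parameter `μ - 1`. -/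
theorem one_add_dotProduct_self_mul_pearsonVII {μ : ℝ} (hμ : (Fintype.card ι : ℝ) / 2 + 1 < μ)
    (x : ι → ℝ) :
    (1 + x ⬝ᵥ x) * pearsonVII μ x =
      (μ - 1) / (μ - 1 - (Fintype.card ι : ℝ) / 2) * pearsonVII (μ - 1) x := by
  have hc : 0 ≤ (Fintype.card ι : ℝ) / 2 := by positivity
  have hx := zero_le_dotProduct_self x
  have h1 : Real.Gamma μ = (μ - 1) * Real.Gamma (μ - 1) := by
    rw [← Real.Gamma_add_one (by linarith)]; ring_nf
  have h2 : Real.Gamma (μ - (Fintype.card ι : ℝ) / 2) =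
      (μ - 1 - (Fintype.card ι : ℝ) / 2) * Real.Gamma (μ - 1 - (Fintype.card ι : ℝ) / 2) := by
    rw [← Real.Gamma_add_one (by linarith)]; ring_nf
  have h3 : (1 + x ⬝ᵥ x) * (1 + x ⬝ᵥ x) ^ (-μ) = (1 + x ⬝ᵥ x) ^ (-(μ - 1)) := by
    rw [show -(μ - 1) = 1 + -μ by ring, Real.rpow_add (by positivity), Real.rpow_one]
  have hΓ' : 0 < Real.Gamma (μ - 1 - (Fintype.card ι : ℝ) / 2) :=
    Real.Gamma_pos_of_pos (by linarith)
  have hπ := Real.pi_pos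
  have : μ - 1 - (Fintype.card ι : ℝ) / 2 ≠ 0 := by linarith
  unfold pearsonVII
  rw [mul_left_comm, h3, h1, h2, mul_left_comm (Real.pi ^ _), mul_div_mul_comm, mul_assoc]

/-- Writing `xᵀx = (1 + xᵀx) - 1` reduces the second moment to two normalised densities, with
parameters `μ - 1` and `μ`. -/
theorem integrable_dotProduct_self_mul_pearsonVII {μ : ℝ}
    (hμ : (Fintype.card ι : ℝ) / 2 + 1 < μ) :
    Integrable fun x : ι → ℝ => x ⬝ᵥ x * pearsonVII μ x := by
  have h (x : ι → ℝ) : x ⬝ᵥ x * pearsonVII μ x =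
      (μ - 1) / (μ - 1 - (Fintype.card ι : ℝ) / 2) * pearsonVII (μ - 1) x - pearsonVII μ x := by
    rw [← one_add_dotProduct_self_mul_pearsonVII hμ]; ring
  simp_rw [h]
  exact ((integrable_pearsonVII (by linarith)).const_mul _).sub
    (integrable_pearsonVII (by linarith))

theorem integral_dotProduct_self_mul_pearsonVII {μ : ℝ}
    (hμ : (Fintype.card ι : ℝ) / 2 + 1 < μ) :
    ∫ x : ι → ℝ, x ⬝ᵥ x * pearsonVII μ x =
      (Fintype.card ι : ℝ) / (2 * (μ - 1 - (Fintype.card ι : ℝ) / 2)) := by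
  have h (x : ι → ℝ) : x ⬝ᵥ x * pearsonVII μ x =
      (μ - 1) / (μ - 1 - (Fintype.card ι : ℝ) / 2) * pearsonVII (μ - 1) x - pearsonVII μ x := by
    rw [← one_add_dotProduct_self_mul_pearsonVII hμ]; ring
  simp_rw [h]
  rw [integral_sub ((integrable_pearsonVII (by linarith)).const_mul _)
    (integrable_pearsonVII (by linarith)), integral_const_mul, integral_pearsonVII (by linarith),
    integral_pearsonVII (by linarith)]
  rw [div_mul_eq_mul_div, mul_one, div_sub_one (by linarith), mul_comm 2, ← div_div,
    div_right_comm]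
  ring_nf

end PearsonIntegral

/-! ### Linear substitutions and the positive square root. -/

section ChangeOfVariables

variable {ι : Type*} [Fintype ι] [DecidableEq ι]

theorem Matrix.PosDef.cfc_sqrt_mul_self {D : Matrix ι ι ℝ} (hD : D.PosDef) :
    cfc Real.sqrt D * cfc Real.sqrt D = D := by
  have hs : IsSelfAdjoint D := hD.1
  rw [← cfc_mul Real.sqrt Real.sqrt D]
  conv_rhs => rw [← cfc_id ℝ D]
  refine cfc_congr fun x hx => ?_
  rw [hD.1.spectrum_real_eq_range_eigenvalues] at hx
  obtain ⟨i, rfl⟩ := hx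
  exact Real.mul_self_sqrt (hD.eigenvalues_pos i).le

theorem cfc_sqrt_transpose (D : Matrix ι ι ℝ) :
    (cfc Real.sqrt D).transpose = cfc Real.sqrt D := by
  have h : IsSelfAdjoint (cfc Real.sqrt D) := cfc_predicate Real.sqrt D
  rw [← Matrix.conjTranspose_eq_transpose_of_trivial]
  exact h

theorem measurableEmbedding_mulVec {M : Matrix ι ι ℝ} (hM : M.det ≠ 0) :
    MeasurableEmbedding fun x : ι → ℝ => M.mulVec x := by
  have := M.invertibleOfIsUnitDet hM.isUnit
  exact (Matrix.toLinearEquiv' M this).toContinuousLinearEquiv.toHomeomorph.measurableEmbedding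

/-- An invertible `M` is a measurable embedding that scales Lebesgue measure by a nonzero constant,
so `f` may be arbitrary. -/
theorem integrable_comp_mulVec_iff {M : Matrix ι ι ℝ} (hM : M.det ≠ 0) (f : (ι → ℝ) → ℝ) :
    Integrable (fun x => f (M.mulVec x)) ↔ Integrable f := by
  have h := Real.map_matrix_volume_pi_eq_smul_volume_pi hM
  have h' := (measurableEmbedding_mulVec hM).integrable_map_iff (μ := volume) (g := f)
  change Integrable f (Measure.map (Matrix.toLin' M) volume) ↔ _ at h'
  rw [h, integrable_smul_measure (by simpa using hM) ENNReal.ofReal_ne_top] at h'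
  exact h'.symm

theorem integral_comp_mulVec {M : Matrix ι ι ℝ} (hM : M.det ≠ 0) (f : (ι → ℝ) → ℝ) :
    ∫ x, f x = |M.det| * ∫ x, f (M.mulVec x) := by
  have h := Real.map_matrix_volume_pi_eq_smul_volume_pi hM
  have h' := (measurableEmbedding_mulVec hM).integral_map (μ := volume) f
  change ∫ y, f y ∂(Measure.map (Matrix.toLin' M) volume) = _ at h'
  rw [h, integral_smul_measure, ENNReal.toReal_ofReal (abs_nonneg _)] at h'
  rw [← h', smul_eq_mul, abs_inv, mul_inv_cancel_left₀ (abs_ne_zero.2 hM)]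

theorem Matrix.PosDef.det_cfc_sqrt_ne_zero {D : Matrix ι ι ℝ} (hD : D.PosDef) :
    (cfc Real.sqrt D).det ≠ 0 := fun h => hD.det_pos.ne' <| by
  rw [← hD.cfc_sqrt_mul_self, Matrix.det_mul, h, zero_mul]

theorem Matrix.PosDef.abs_det_cfc_sqrt {D : Matrix ι ι ℝ} (hD : D.PosDef) :
    |(cfc Real.sqrt D).det| = D.det ^ ((1 : ℝ) / 2) := by
  conv_rhs => rw [← hD.cfc_sqrt_mul_self, Matrix.det_mul]
  rw [← Real.sqrt_eq_rpow, Real.sqrt_mul_self_eq_abs]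

theorem Matrix.PosDef.dotProduct_inv_mulVec_cfc_sqrt {D : Matrix ι ι ℝ} (hD : D.PosDef)
    (y : ι → ℝ) :
    (cfc Real.sqrt D).mulVec y ⬝ᵥ D⁻¹.mulVec ((cfc Real.sqrt D).mulVec y) = y ⬝ᵥ y := by
  have hu : IsUnit (cfc Real.sqrt D).det := hD.det_cfc_sqrt_ne_zero.isUnit
  have h : cfc Real.sqrt D * D⁻¹ * cfc Real.sqrt D = 1 := by
    have h : D⁻¹ = (cfc Real.sqrt D)⁻¹ * (cfc Real.sqrt D)⁻¹ := by
      rw [← Matrix.mul_inv_rev, hD.cfc_sqrt_mul_self]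
    rw [h, ← mul_assoc, Matrix.mul_nonsing_inv _ hu, one_mul, Matrix.nonsing_inv_mul _ hu]
  rw [Matrix.dotProduct_mulVec, Matrix.dotProduct_mulVec, ← Matrix.mulVec_transpose,
    ← Matrix.mulVec_transpose, Matrix.mulVec_mulVec, Matrix.mulVec_mulVec, cfc_sqrt_transpose]
  have h' := congrArg Matrix.transpose h
  simp only [Matrix.transpose_mul, cfc_sqrt_transpose, Matrix.transpose_one, ← mul_assoc] at h'
  rw [h', Matrix.one_mulVec]

end ChangeOfVariables

/-! ### Power integrals and moments of the Rényi density. -/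

section RenyiDensity

theorem two_mul_sub_mul_one_sub_pos {n : ℕ} {r : ℝ} (hr : (n : ℝ) / (n + 2) < r) :
    0 < 2 * r - n * (1 - r) := by
  rw [div_lt_iff₀ (by positivity)] at hr
  linarith

/-- Up to scaling, `g_{r,D}` is a Pearson VII density with `μ = 1/(1-r)`; this is the range of `μ`
needed for the second moment computation. -/
theorem half_add_one_lt_one_div {n : ℕ} {r : ℝ} (hr : (n : ℝ) / (n + 2) < r) (hr1 : r < 1) :
    (n : ℝ) / 2 + 1 < 1 / (1 - r) := by
  have := two_mul_sub_mul_one_sub_pos hr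
  rw [lt_div_iff₀ (by linarith)]
  linarith

theorem renyiBeta_mul_one_sub_pos {n : ℕ} {r : ℝ} (hr : (n : ℝ) / (n + 2) < r) (hr1 : r < 1) :
    0 < renyiBeta n r * (1 - r) :=
  mul_pos (one_div_pos.2 (two_mul_sub_mul_one_sub_pos hr)) (by linarith)

theorem two_mul_div_sub_half {n : ℕ} {r : ℝ} (hr1 : r < 1) :
    2 * (r / (1 - r) - (n : ℝ) / 2) = (renyiBeta n r * (1 - r))⁻¹ := by
  have : 1 - r ≠ 0 := by linarith
  rw [renyiBeta, mul_inv, one_div, inv_inv, eq_mul_inv_iff_mul_eq₀ this, mul_assoc, sub_mul,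
    div_mul_cancel₀ _ this]
  ring

variable {ι : Type*} [Fintype ι] [DecidableEq ι]

theorem renyiA_pos {r : ℝ} (hr : (Fintype.card ι : ℝ) / (Fintype.card ι + 2) < r) (hr1 : r < 1)
    {D : Matrix ι ι ℝ} (hD : D.PosDef) : 0 < renyiA r D := by
  have h1 := half_add_one_lt_one_div hr hr1
  have h2 : 0 < Real.Gamma (1 / (1 - r)) := Real.Gamma_pos_of_pos (one_div_pos.2 (by linarith))
  have h3 : 0 < Real.Gamma (1 / (1 - r) - (Fintype.card ι : ℝ) / 2) :=
    Real.Gamma_pos_of_pos (by linarith)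
  have h4 := renyiBeta_mul_one_sub_pos hr hr1
  have h5 := hD.det_pos
  have h6 := Real.pi_pos
  unfold renyiA
  positivity

theorem renyiDensity_base_pos {r : ℝ} (hr : (Fintype.card ι : ℝ) / (Fintype.card ι + 2) < r)
    (hr1 : r < 1) {D : Matrix ι ι ℝ} (hD : D.PosDef) (x : ι → ℝ) :
    0 < 1 + (1 - r) * renyiBeta (Fintype.card ι) r * (x ⬝ᵥ (D⁻¹.mulVec x)) := by
  have h : 0 ≤ x ⬝ᵥ (D⁻¹.mulVec x) := by
    simpa using hD.inv.posSemidef.dotProduct_mulVec_nonneg x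
  have := renyiBeta_mul_one_sub_pos hr hr1
  rw [mul_comm (1 - r)]
  positivity

theorem renyiDensity_pos {r : ℝ} (hr : (Fintype.card ι : ℝ) / (Fintype.card ι + 2) < r)
    (hr1 : r < 1) {D : Matrix ι ι ℝ} (hD : D.PosDef) (x : ι → ℝ) : 0 < renyiDensity r D x :=
  mul_pos (renyiA_pos hr hr1 hD) (Real.rpow_pos_of_pos (renyiDensity_base_pos hr hr1 hD x) _)

theorem measurable_renyiDensity (r : ℝ) (D : Matrix ι ι ℝ) : Measurable (renyiDensity r D) := by
  unfold renyiDensity Matrix.mulVec dotProduct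
  fun_prop

theorem renyiDensity_rpow_sub_one {r : ℝ}
    (hr : (Fintype.card ι : ℝ) / (Fintype.card ι + 2) < r) (hr1 : r < 1)
    {D : Matrix ι ι ℝ} (hD : D.PosDef) (x : ι → ℝ) :
    renyiDensity r D x ^ (r - 1) = renyiA r D ^ (r - 1) *
      (1 + (1 - r) * renyiBeta (Fintype.card ι) r * (x ⬝ᵥ (D⁻¹.mulVec x))) := by
  have hb := renyiDensity_base_pos hr hr1 hD x
  have : r - 1 ≠ 0 := by linarith
  rw [renyiDensity, Real.mul_rpow (renyiA_pos hr hr1 hD).le (by positivity), ← Real.rpow_mul hb.le,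
    one_div_mul_cancel this, Real.rpow_one]

/-- The substitution `x = s D^{1/2} y` turns `renyiDensity` into a multiple of a power of
`1 + yᵀ y`. -/
theorem renyiDensity_sqrt_smul_mulVec {r : ℝ}
    (hr : (Fintype.card ι : ℝ) / (Fintype.card ι + 2) < r) (hr1 : r < 1)
    {D : Matrix ι ι ℝ} (hD : D.PosDef) (y : ι → ℝ) :
    renyiDensity r D (Real.sqrt (2 * (r / (1 - r) - (Fintype.card ι : ℝ) / 2)) •
      (cfc Real.sqrt D).mulVec y) = renyiA r D * (1 + y ⬝ᵥ y) ^ (1 / (r - 1)) := by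
  have hb := renyiBeta_mul_one_sub_pos hr hr1
  rw [two_mul_div_sub_half hr1, renyiDensity, Matrix.mulVec_smul, smul_dotProduct, dotProduct_smul,
    hD.dotProduct_inv_mulVec_cfc_sqrt, smul_smul, smul_eq_mul, Real.mul_self_sqrt (by positivity),
    mul_comm (1 - r), mul_inv_cancel_left₀ hb.ne']

theorem varpiStar_pos {n : ℕ} {r q : ℝ} (hr : (n : ℝ) / (n + 2) < r) (hr1 : r < 1)
    (hq : (1 - r) * n / 2 < q) : 0 < varpiStar n r q := by
  have h1 := half_add_one_lt_one_div hr hr1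
  have hr' : 0 < 1 - r := by linarith
  have hq' : (n : ℝ) / 2 < q / (1 - r) := by rw [lt_div_iff₀ hr']; linarith
  have hn : (0 : ℝ) ≤ (n : ℝ) / 2 := by positivity
  have h2 : 0 < Real.Gamma (1 / (1 - r)) := Real.Gamma_pos_of_pos (by linarith)
  have h3 : 0 < Real.Gamma (1 / (1 - r) - (n : ℝ) / 2) := Real.Gamma_pos_of_pos (by linarith)
  have h4 : 0 < Real.Gamma (q / (1 - r)) := Real.Gamma_pos_of_pos (by linarith)
  have h5 : 0 < Real.Gamma (q / (1 - r) - (n : ℝ) / 2) := Real.Gamma_pos_of_pos (by linarith)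
  have hb := renyiBeta_mul_one_sub_pos hr hr1
  have hπ := Real.pi_pos
  unfold varpiStar
  positivity

theorem varpiStar_one {n : ℕ} {r : ℝ} (hr : (n : ℝ) / (n + 2) < r) (hr1 : r < 1) :
    varpiStar n r 1 = 1 := by
  have h1 := half_add_one_lt_one_div hr hr1
  have hn : (0 : ℝ) ≤ (n : ℝ) / 2 := by positivity
  have h2 : 0 < Real.Gamma (1 / (1 - r)) := Real.Gamma_pos_of_pos (by linarith)
  have h3 : 0 < Real.Gamma (1 / (1 - r) - (n : ℝ) / 2) := Real.Gamma_pos_of_pos (by linarith)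
  simp only [varpiStar, sub_self, mul_zero, zero_div, Real.rpow_zero, Real.rpow_one, mul_one]
  rw [mul_comm, div_self (by positivity)]

theorem rpow_mul_sub_one_div_two {b : ℝ} (hb : 0 < b) (m q : ℝ) :
    b ^ (m * (q - 1) / 2) = (b ^ (m / 2)) ^ q / b ^ (m / 2) := by
  rw [← Real.rpow_mul hb.le, ← Real.rpow_sub hb]
  ring_nf

/-- Under `x = s D^{1/2} y` the power `g^q` becomes a Pearson density up to a ratio of normalising
constants. The constants are matched here with the Jacobian of the substitution. -/
theorem varpiStar_mul_det_rpow {r q : ℝ}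
    (hr : (Fintype.card ι : ℝ) / (Fintype.card ι + 2) < r) (hr1 : r < 1)
    (hq : (1 - r) * Fintype.card ι / 2 < q) {D : Matrix ι ι ℝ} (hD : D.PosDef) :
    varpiStar (Fintype.card ι) r q * D.det ^ ((1 - q) / 2) *
      (Real.Gamma (q / (1 - r)) / (Real.pi ^ ((Fintype.card ι : ℝ) / 2) *
        Real.Gamma (q / (1 - r) - (Fintype.card ι : ℝ) / 2)) / renyiA r D ^ q) =
    |(Real.sqrt (2 * (r / (1 - r) - (Fintype.card ι : ℝ) / 2)) • cfc Real.sqrt D).det| := by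
  have h1 := half_add_one_lt_one_div hr hr1
  have hr' : 0 < 1 - r := by linarith
  have hq' : (Fintype.card ι : ℝ) / 2 < q / (1 - r) := by rw [lt_div_iff₀ hr']; linarith
  have hn : (0 : ℝ) ≤ (Fintype.card ι : ℝ) / 2 := by positivity
  have h2 : 0 < Real.Gamma (1 / (1 - r)) := Real.Gamma_pos_of_pos (by linarith)
  have h3 : 0 < Real.Gamma (1 / (1 - r) - (Fintype.card ι : ℝ) / 2) :=
    Real.Gamma_pos_of_pos (by linarith)
  have h4 : 0 < Real.Gamma (q / (1 - r)) := Real.Gamma_pos_of_pos (by linarith)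
  have h5 : 0 < Real.Gamma (q / (1 - r) - (Fintype.card ι : ℝ) / 2) :=
    Real.Gamma_pos_of_pos (by linarith)
  have hb := renyiBeta_mul_one_sub_pos hr hr1
  have hπ := Real.pi_pos
  have hd := hD.det_pos
  have hdet : D.det ^ ((1 - q) / 2) = D.det ^ ((1 : ℝ) / 2) / (D.det ^ ((1 : ℝ) / 2)) ^ q := by
    rw [← Real.rpow_mul hd.le, ← Real.rpow_sub hd]
    ring_nf
  have hs : Real.sqrt (renyiBeta (Fintype.card ι) r * (1 - r))⁻¹ ^ Fintype.card ι =
      ((renyiBeta (Fintype.card ι) r * (1 - r)) ^ ((Fintype.card ι : ℝ) / 2))⁻¹ := by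
    rw [Real.sqrt_eq_rpow, Real.inv_rpow hb.le, inv_pow, ← Real.rpow_natCast, ← Real.rpow_mul hb.le]
    ring_nf
  rw [Matrix.det_smul, abs_mul, hD.abs_det_cfc_sqrt, abs_of_nonneg (by positivity),
    two_mul_div_sub_half hr1, hs, hdet, varpiStar, renyiA, rpow_mul_sub_one_div_two hb,
    rpow_mul_sub_one_div_two hπ]
  -- Gamma values and half-dimension powers become positive atoms, leaving an identity between
  -- monomials in the atoms and their `q`-th powers.
  generalize renyiBeta (Fintype.card ι) r * (1 - r) = b at *
  generalize Real.Gamma (1 / (1 - r)) = g₁ at *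
  generalize Real.Gamma (1 / (1 - r) - (Fintype.card ι : ℝ) / 2) = g₂ at *
  generalize Real.Gamma (q / (1 - r)) = g₃ at *
  generalize Real.Gamma (q / (1 - r) - (Fintype.card ι : ℝ) / 2) = g₄ at *
  have hX : 0 < b ^ ((Fintype.card ι : ℝ) / 2) := by positivity
  have hP : 0 < Real.pi ^ ((Fintype.card ι : ℝ) / 2) := by positivity
  have hd' : 0 < D.det ^ ((1 : ℝ) / 2) := by positivity
  generalize b ^ ((Fintype.card ι : ℝ) / 2) = X at *
  generalize Real.pi ^ ((Fintype.card ι : ℝ) / 2) = P at *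
  generalize D.det ^ ((1 : ℝ) / 2) = d at *
  rw [Real.div_rpow (by positivity) (by positivity), Real.mul_rpow (by positivity) (by positivity),
    Real.mul_rpow (by positivity) (by positivity), Real.mul_rpow (by positivity) (by positivity)]
  have : 0 < g₁ ^ q := by positivity
  have : 0 < g₂ ^ q := by positivity
  have : 0 < X ^ q := by positivity
  have : 0 < P ^ q := by positivity
  have : 0 < d ^ q := by positivity
  field_simp

theorem alphaStarIntegrand_eq {r : ℝ} (q : ℝ)
    (hr : (Fintype.card ι : ℝ) / (Fintype.card ι + 2) < r) (hr1 : r < 1)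
    {D : Matrix ι ι ℝ} (hD : D.PosDef) (φ : (ι → ℝ) → ℝ) (y : ι → ℝ) :
    alphaStarIntegrand φ r q D y =
      Real.Gamma (q / (1 - r)) / (Real.pi ^ ((Fintype.card ι : ℝ) / 2) *
        Real.Gamma (q / (1 - r) - (Fintype.card ι : ℝ) / 2)) / renyiA r D ^ q *
      (fun x => φ x * renyiDensity r D x ^ q)
        ((Real.sqrt (2 * (r / (1 - r) - (Fintype.card ι : ℝ) / 2)) • cfc Real.sqrt D).mulVec y) := by
  have hA := renyiA_pos hr hr1 hD
  have hy := zero_le_dotProduct_self y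
  have : 0 < renyiA r D ^ q := by positivity
  beta_reduce
  rw [Matrix.smul_mulVec, renyiDensity_sqrt_smul_mulVec hr hr1 hD,
    Real.mul_rpow hA.le (by positivity), ← Real.rpow_mul (by positivity),
    show 1 / (r - 1) * q = -(q / (1 - r)) by rw [← neg_sub 1 r, div_neg]; ring,
    alphaStarIntegrand, rhoStar, pearsonVII]
  field_simp

theorem det_sqrt_smul_cfc_sqrt_ne_zero {r : ℝ}
    (hr : (Fintype.card ι : ℝ) / (Fintype.card ι + 2) < r) (hr1 : r < 1)
    {D : Matrix ι ι ℝ} (hD : D.PosDef) :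
    (Real.sqrt (2 * (r / (1 - r) - (Fintype.card ι : ℝ) / 2)) • cfc Real.sqrt D).det ≠ 0 := by
  rw [Matrix.det_smul, two_mul_div_sub_half hr1]
  exact mul_ne_zero
    (pow_ne_zero _ (Real.sqrt_pos.2 (inv_pos.2 (renyiBeta_mul_one_sub_pos hr hr1))).ne')
    hD.det_cfc_sqrt_ne_zero

theorem integrable_alphaStarIntegrand_iff {r q : ℝ}
    (hr : (Fintype.card ι : ℝ) / (Fintype.card ι + 2) < r) (hr1 : r < 1)
    (hq : (1 - r) * Fintype.card ι / 2 < q) {D : Matrix ι ι ℝ} (hD : D.PosDef)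
    (φ : (ι → ℝ) → ℝ) :
    Integrable (alphaStarIntegrand φ r q D) ↔
      Integrable fun x => φ x * renyiDensity r D x ^ q := by
  have hK := varpiStar_mul_det_rpow hr hr1 hq hD
  have hM := det_sqrt_smul_cfc_sqrt_ne_zero hr hr1 hD
  have hK0 := right_ne_zero_of_mul (hK.trans_ne (abs_ne_zero.2 hM))
  rw [funext (alphaStarIntegrand_eq q hr hr1 hD φ), integrable_const_mul_iff hK0.isUnit,
    integrable_comp_mulVec_iff hM fun x => φ x * renyiDensity r D x ^ q]

/-- The weighted power integral of `renyiDensity` is `ϖ* (det D)^{(1 - q) / 2} α*`. -/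
theorem integral_mul_renyiDensity_rpow {r q : ℝ}
    (hr : (Fintype.card ι : ℝ) / (Fintype.card ι + 2) < r) (hr1 : r < 1)
    (hq : (1 - r) * Fintype.card ι / 2 < q) {D : Matrix ι ι ℝ} (hD : D.PosDef)
    (φ : (ι → ℝ) → ℝ) :
    ∫ x, φ x * renyiDensity r D x ^ q =
      varpiStar (Fintype.card ι) r q * D.det ^ ((1 - q) / 2) * alphaStar φ r q D := by
  rw [integral_comp_mulVec (det_sqrt_smul_cfc_sqrt_ne_zero hr hr1 hD), alphaStar,
    funext (alphaStarIntegrand_eq q hr hr1 hD φ), integral_const_mul, ← mul_assoc,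
    varpiStar_mul_det_rpow hr hr1 hq hD]

theorem one_sub_mul_div_two_lt_one {n : ℕ} {r : ℝ} (hr : (n : ℝ) / (n + 2) < r) (hr1 : r < 1) :
    (1 - r) * n / 2 < 1 := by
  have := two_mul_sub_mul_one_sub_pos hr
  linarith

theorem one_sub_mul_div_two_lt_self {n : ℕ} {r : ℝ} (hr : (n : ℝ) / (n + 2) < r) :
    (1 - r) * n / 2 < r := by
  have := two_mul_sub_mul_one_sub_pos hr
  linarith

theorem half_lt_div_one_sub {n : ℕ} {r q : ℝ} (hr1 : r < 1) (hq : (1 - r) * n / 2 < q) :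
    (n : ℝ) / 2 < q / (1 - r) := by
  rw [lt_div_iff₀ (by linarith)]
  linarith

theorem rhoStar_one (φ : (ι → ℝ) → ℝ) (r : ℝ) (y : ι → ℝ) :
    rhoStar φ r (1 : Matrix ι ι ℝ) y =
      φ (Real.sqrt (2 * (r / (1 - r) - (Fintype.card ι : ℝ) / 2)) • y) := by
  rw [rhoStar, cfc_apply_one, Real.sqrt_one, map_one, Matrix.one_mulVec]

theorem integrable_renyiDensity_one_rpow {r q : ℝ}
    (hr : (Fintype.card ι : ℝ) / (Fintype.card ι + 2) < r) (hr1 : r < 1)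
    (hq : (1 - r) * Fintype.card ι / 2 < q) :
    Integrable fun x => renyiDensity r (1 : Matrix ι ι ℝ) x ^ q := by
  have h := (integrable_alphaStarIntegrand_iff hr hr1 hq (.one : (1 : Matrix ι ι ℝ).PosDef)
    fun _ => 1).1 ((integrable_pearsonVII (half_lt_div_one_sub hr1 hq)).congr
      (ae_of_all _ fun y => (one_mul (pearsonVII (q / (1 - r)) y)).symm))
  simpa only [one_mul] using h

theorem integral_renyiDensity_one_rpow {r q : ℝ}
    (hr : (Fintype.card ι : ℝ) / (Fintype.card ι + 2) < r) (hr1 : r < 1)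
    (hq : (1 - r) * Fintype.card ι / 2 < q) :
    ∫ x, renyiDensity r (1 : Matrix ι ι ℝ) x ^ q = varpiStar (Fintype.card ι) r q := by
  have h := integral_mul_renyiDensity_rpow hr hr1 hq (.one : (1 : Matrix ι ι ℝ).PosDef)
    fun _ => 1
  simpa only [alphaStar, alphaStarIntegrand, rhoStar, one_mul, Matrix.det_one, Real.one_rpow,
    mul_one, integral_pearsonVII (half_lt_div_one_sub hr1 hq)] using h

theorem integrable_renyiDensity_one {r : ℝ}
    (hr : (Fintype.card ι : ℝ) / (Fintype.card ι + 2) < r) (hr1 : r < 1) :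
    Integrable (renyiDensity r (1 : Matrix ι ι ℝ)) := by
  simpa only [Real.rpow_one] using
    integrable_renyiDensity_one_rpow hr hr1 (one_sub_mul_div_two_lt_one hr hr1)

theorem integral_renyiDensity_one {r : ℝ}
    (hr : (Fintype.card ι : ℝ) / (Fintype.card ι + 2) < r) (hr1 : r < 1) :
    ∫ x, renyiDensity r (1 : Matrix ι ι ℝ) x = 1 := by
  simpa only [Real.rpow_one, varpiStar_one hr hr1] using
    integral_renyiDensity_one_rpow hr hr1 (one_sub_mul_div_two_lt_one hr hr1)

theorem alphaStarIntegrand_dotProduct_self {r : ℝ} (q : ℝ)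
    (hr : (Fintype.card ι : ℝ) / (Fintype.card ι + 2) < r) (hr1 : r < 1) (y : ι → ℝ) :
    alphaStarIntegrand (fun x => x ⬝ᵥ x) r q (1 : Matrix ι ι ℝ) y =
      2 * (r / (1 - r) - (Fintype.card ι : ℝ) / 2) * (y ⬝ᵥ y * pearsonVII (q / (1 - r)) y) := by
  have hs : 0 ≤ 2 * (r / (1 - r) - (Fintype.card ι : ℝ) / 2) := by
    rw [two_mul_div_sub_half hr1]
    exact (inv_pos.2 (renyiBeta_mul_one_sub_pos hr hr1)).le
  rw [alphaStarIntegrand, rhoStar_one, smul_dotProduct, dotProduct_smul, smul_smul,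
    Real.mul_self_sqrt hs, smul_eq_mul, mul_assoc]

theorem integrable_dotProduct_self_mul_renyiDensity_one {r : ℝ}
    (hr : (Fintype.card ι : ℝ) / (Fintype.card ι + 2) < r) (hr1 : r < 1) :
    Integrable fun x => x ⬝ᵥ x * renyiDensity r (1 : Matrix ι ι ℝ) x := by
  have h := (integrable_alphaStarIntegrand_iff hr hr1 (one_sub_mul_div_two_lt_one hr hr1)
    (.one : (1 : Matrix ι ι ℝ).PosDef) fun x => x ⬝ᵥ x).1 (by
      rw [funext (alphaStarIntegrand_dotProduct_self 1 hr hr1)]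
      exact (integrable_dotProduct_self_mul_pearsonVII (half_add_one_lt_one_div hr hr1)).const_mul _)
  simpa only [Real.rpow_one] using h

/-- The trace of the covariance matrix of `g_{r,1}` is the dimension. -/
theorem integral_dotProduct_self_mul_renyiDensity_one {r : ℝ}
    (hr : (Fintype.card ι : ℝ) / (Fintype.card ι + 2) < r) (hr1 : r < 1) :
    ∫ x, x ⬝ᵥ x * renyiDensity r (1 : Matrix ι ι ℝ) x = Fintype.card ι := by
  have h := integral_mul_renyiDensity_rpow hr hr1 (one_sub_mul_div_two_lt_one hr hr1)
    (.one : (1 : Matrix ι ι ℝ).PosDef) fun x => x ⬝ᵥ x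
  rw [alphaStar, funext (alphaStarIntegrand_dotProduct_self 1 hr hr1), integral_const_mul,
    integral_dotProduct_self_mul_pearsonVII (half_add_one_lt_one_div hr hr1)] at h
  simp only [Real.rpow_one, Matrix.det_one, Real.one_rpow, varpiStar_one hr hr1, one_mul] at h
  have hr' : 1 - r ≠ 0 := by linarith
  have hs : 2 * (r / (1 - r) - (Fintype.card ι : ℝ) / 2) ≠ 0 := by
    rw [two_mul_div_sub_half hr1]
    exact (inv_pos.2 (renyiBeta_mul_one_sub_pos hr hr1)).ne'
  -- With `μ = 1/(1-r)`, the denominator of the Pearson second moment is exactly the squared scale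
  -- `s²`, so only the dimension survives.
  rw [h, show 1 / (1 - r) - 1 = r / (1 - r) by rw [div_sub_one hr', sub_sub_cancel],
    mul_div_cancel₀ _ hs]

end RenyiDensity

/-! ### Product functions on a sum of index types, and the tangent inequality. -/

theorem measurable_prodWeight {ι κ : Type*} {f : (ι → ℝ) → ℝ} {g : (κ → ℝ) → ℝ} (hf : Measurable f)
    (hg : Measurable g) : Measurable (prodWeight f g) := by
  unfold prodWeight
  fun_prop

section SumType

variable {ι κ : Type*} [Fintype ι] [Fintype κ]

theorem integrable_prodWeight {f : (ι → ℝ) → ℝ} {g : (κ → ℝ) → ℝ} (hf : Integrable f)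
    (hg : Integrable g) : Integrable (prodWeight f g) :=
  ((volume_measurePreserving_sumPiEquivProdPi fun _ : ι ⊕ κ => ℝ).integrable_comp_emb
    (MeasurableEquiv.measurableEmbedding _)).2 (hf.mul_prod hg)

theorem integral_prodWeight (f : (ι → ℝ) → ℝ) (g : (κ → ℝ) → ℝ) :
    ∫ x, prodWeight f g x = (∫ x, f x) * ∫ x, g x := by
  have h := (volume_measurePreserving_sumPiEquivProdPi fun _ : ι ⊕ κ => ℝ).integral_comp
    (MeasurableEquiv.measurableEmbedding _) fun z : (ι → ℝ) × (κ → ℝ) => f z.1 * g z.2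
  exact h.trans (integral_prod_mul f g)

theorem dotProduct_self_sum (x : ι ⊕ κ → ℝ) :
    x ⬝ᵥ x = (fun i => x (Sum.inl i)) ⬝ᵥ (fun i => x (Sum.inl i)) +
      (fun k => x (Sum.inr k)) ⬝ᵥ (fun k => x (Sum.inr k)) :=
  Fintype.sum_sum_type _

end SumType

/-- Weighted AM-GM in the form used for Hölder's inequality with exponents `1/p`, `1/(1-p)`. -/
theorem rpow_le_add_mul_rpow_sub_one_mul_sub {F G p : ℝ} (hF : 0 < F) (hG : 0 < G) (hp : 0 < p)
    (hp1 : p < 1) : G ^ p ≤ F ^ p + p * (F ^ (p - 1) * (G - F)) := by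
  have h := Real.geom_mean_le_arith_mean2_weighted hp.le (sub_nonneg.2 hp1.le)
    (p₁ := F ^ (p - 1) * G) (p₂ := F ^ p) (by positivity) (by positivity) (by ring)
  -- The two means were chosen so that all powers of `F` cancel in the geometric mean.
  have hl : (F ^ (p - 1) * G) ^ p * (F ^ p) ^ (1 - p) = G ^ p := by
    rw [Real.mul_rpow (by positivity) hG.le, mul_right_comm, ← Real.rpow_mul hF.le,
      ← Real.rpow_mul hF.le, ← Real.rpow_add hF, show (p - 1) * p + p * (1 - p) = 0 by ring,
      Real.rpow_zero, one_mul]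
  have hF' : F ^ (p - 1) * F = F ^ p := by
    rw [← Real.rpow_add_one hF.ne', sub_add_cancel]
  rw [hl] at h
  linear_combination h + p * hF'

/-- The tangent inequality both dominates `w G^p` by an integrable function and, once integrated,
compares the two integrals. It is used twice, with the roles of product and joint density exchanged.
-/
theorem integrable_and_integral_mul_rpow_le {α : Type*} [MeasurableSpace α] {μ : Measure α}
    {w F G : α → ℝ} {p : ℝ} (hp : 0 < p) (hp1 : p < 1) (hw : ∀ x, 0 ≤ w x) (hF : ∀ x, 0 < F x)
    (hG : ∀ x, 0 < G x) (hwG : AEStronglyMeasurable (fun x => w x * G x ^ p) μ)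
    (hFi : Integrable (fun x => w x * F x ^ p) μ)
    (hi : Integrable (fun x => w x * F x ^ (p - 1) * (G x - F x)) μ)
    (hle : ∫ x, w x * F x ^ (p - 1) * (G x - F x) ∂μ ≤ 0) :
    Integrable (fun x => w x * G x ^ p) μ ∧
      ∫ x, w x * G x ^ p ∂μ ≤ ∫ x, w x * F x ^ p ∂μ := by
  have key (x : α) : w x * G x ^ p ≤
      w x * F x ^ p + p * (w x * F x ^ (p - 1) * (G x - F x)) := by
    have := mul_le_mul_of_nonneg_left
      (rpow_le_add_mul_rpow_sub_one_mul_sub (hF x) (hG x) hp hp1) (hw x)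
    linarith
  have hsum := hFi.add (hi.const_mul p)
  have hint : Integrable (fun x => w x * G x ^ p) μ := by
    refine hsum.mono' hwG (ae_of_all _ fun x => ?_)
    rw [Real.norm_of_nonneg (mul_nonneg (hw x) (Real.rpow_nonneg (hG x).le _))]
    exact key x
  refine ⟨hint, (integral_mono hint hsum key).trans ?_⟩
  simp only [Pi.add_apply]
  rw [integral_add hFi (hi.const_mul p), integral_const_mul]
  have := mul_nonpos_of_nonneg_of_nonpos hp.le hle
  linarith

/-! ### Entropy comparison and the theorem. -/

section Main

variable {ι κ : Type*} [Fintype ι] [DecidableEq ι] [Fintype κ] [DecidableEq κ]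

/-- The Rényi density maximises the Rényi entropy among densities of the same covariance; the
product of two lower dimensional ones is a competitor. -/
theorem varpiStar_mul_varpiStar_le {p p₁ p₂ : ℝ}
    (hp : (Fintype.card (ι ⊕ κ) : ℝ) / (Fintype.card (ι ⊕ κ) + 2) < p) (hp1 : p < 1)
    (hp₁ : (Fintype.card ι : ℝ) / (Fintype.card ι + 2) < p₁) (hp₁1 : p₁ < 1)
    (hp₂ : (Fintype.card κ : ℝ) / (Fintype.card κ + 2) < p₂) (hp₂1 : p₂ < 1)
    (hq₁ : (1 - p₁) * Fintype.card ι / 2 < p) (hq₂ : (1 - p₂) * Fintype.card κ / 2 < p) :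
    varpiStar (Fintype.card ι) p₁ p * varpiStar (Fintype.card κ) p₂ p ≤
      varpiStar (Fintype.card (ι ⊕ κ)) p p := by
  have hp0 : 0 < p := lt_of_le_of_lt (by positivity) hp
  set g₁ := renyiDensity p₁ (1 : Matrix ι ι ℝ)
  set g₂ := renyiDensity p₂ (1 : Matrix κ κ ℝ)
  set G := renyiDensity p (1 : Matrix (ι ⊕ κ) (ι ⊕ κ) ℝ)
  set b := (1 - p) * renyiBeta (Fintype.card (ι ⊕ κ)) p
  have hg₁ (x) : 0 < g₁ x := renyiDensity_pos hp₁ hp₁1 .one x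
  have hg₂ (x) : 0 < g₂ x := renyiDensity_pos hp₂ hp₂1 .one x
  have hG (x) : 0 < G x := renyiDensity_pos hp hp1 .one x
  have hF (x) : 0 < prodWeight g₁ g₂ x := mul_pos (hg₁ _) (hg₂ _)
  have hFp : (fun x => prodWeight g₁ g₂ x ^ p) =
      prodWeight (fun x => g₁ x ^ p) (fun x => g₂ x ^ p) :=
    funext fun x => Real.mul_rpow (hg₁ _).le (hg₂ _).le
  have hFm : Measurable fun x => prodWeight g₁ g₂ x ^ p :=
    (measurable_prodWeight (measurable_renyiDensity _ _) (measurable_renyiDensity _ _)).pow_const p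
  have hF2 : (fun x => x ⬝ᵥ x * prodWeight g₁ g₂ x) = fun x =>
      prodWeight (fun x => x ⬝ᵥ x * g₁ x) g₂ x + prodWeight g₁ (fun x => x ⬝ᵥ x * g₂ x) x := by
    funext x
    simp only [prodWeight, dotProduct_self_sum x]
    ring
  have hi₁ := integrable_renyiDensity_one hp₁ hp₁1
  have hi₂ := integrable_renyiDensity_one hp₂ hp₂1
  have hs₁ := integrable_dotProduct_self_mul_renyiDensity_one hp₁ hp₁1
  have hs₂ := integrable_dotProduct_self_mul_renyiDensity_one hp₂ hp₂1
  have hiF : Integrable (prodWeight g₁ g₂) := integrable_prodWeight hi₁ hi₂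
  have hiF2 : Integrable fun x => x ⬝ᵥ x * prodWeight g₁ g₂ x := by
    rw [hF2]
    exact (integrable_prodWeight hs₁ hi₂).add (integrable_prodWeight hi₁ hs₂)
  have hIF : ∫ x, prodWeight g₁ g₂ x = 1 := by
    rw [integral_prodWeight, integral_renyiDensity_one hp₁ hp₁1,
      integral_renyiDensity_one hp₂ hp₂1, one_mul]
  have hIF2 : ∫ x, x ⬝ᵥ x * prodWeight g₁ g₂ x = Fintype.card (ι ⊕ κ) := by
    rw [hF2, integral_add (integrable_prodWeight hs₁ hi₂) (integrable_prodWeight hi₁ hs₂),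
      integral_prodWeight, integral_prodWeight, integral_renyiDensity_one hp₁ hp₁1,
      integral_renyiDensity_one hp₂ hp₂1,
      integral_dotProduct_self_mul_renyiDensity_one hp₁ hp₁1,
      integral_dotProduct_self_mul_renyiDensity_one hp₂ hp₂1, one_mul, mul_one,
      Fintype.card_sum, Nat.cast_add]
  have hiG := integrable_renyiDensity_one hp hp1
  have hsG := integrable_dotProduct_self_mul_renyiDensity_one hp hp1
  -- The exponent `p - 1` undoes `1/(p - 1)`, so `G^(p-1)` is affine in `xᵀx` and only masses and
  -- second moments enter.
  have hdiff : (fun x => 1 * G x ^ (p - 1) * (prodWeight g₁ g₂ x - G x)) = fun x =>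
      renyiA p (1 : Matrix (ι ⊕ κ) (ι ⊕ κ) ℝ) ^ (p - 1) *
        ((prodWeight g₁ g₂ x + b * (x ⬝ᵥ x * prodWeight g₁ g₂ x)) -
          (G x + b * (x ⬝ᵥ x * G x))) := by
    funext x
    rw [renyiDensity_rpow_sub_one hp hp1 .one, inv_one, Matrix.one_mulVec]
    ring
  have hA := hiF.add (hiF2.const_mul b)
  have hB := hiG.add (hsG.const_mul b)
  have hH := (integrable_and_integral_mul_rpow_le (μ := volume) (w := fun _ => 1) (F := G)
    (G := prodWeight g₁ g₂) hp0 hp1 (fun _ => zero_le_one) hG hF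
    (by simpa only [one_mul] using hFm.aestronglyMeasurable)
    (by simpa only [one_mul] using
      integrable_renyiDensity_one_rpow hp hp1 (one_sub_mul_div_two_lt_self hp))
    (by rw [hdiff]; exact (hA.sub hB).const_mul _)
    (by
      -- The correction term vanishes: both densities have mass `1` and second moment equal to the
      -- total dimension.
      refine le_of_eq ?_
      rw [hdiff, integral_const_mul]
      refine mul_eq_zero_of_right _ ((integral_sub hA hB).trans (sub_eq_zero.2 ?_))
      refine (integral_add hiF (hiF2.const_mul b)).trans
        (Eq.trans ?_ (integral_add hiG (hsG.const_mul b)).symm)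
      rw [integral_const_mul, integral_const_mul, hIF, hIF2, integral_renyiDensity_one hp hp1,
        integral_dotProduct_self_mul_renyiDensity_one hp hp1])).2
  simp only [one_mul] at hH
  rwa [hFp, integral_prodWeight, integral_renyiDensity_one_rpow hp₁ hp₁1 hq₁,
    integral_renyiDensity_one_rpow hp₂ hp₂1 hq₂,
    integral_renyiDensity_one_rpow hp hp1 (one_sub_mul_div_two_lt_self hp)] at hH

theorem alphaStar_nonneg {φ : (ι → ℝ) → ℝ} (hφ : ∀ x, 0 ≤ φ x) {r q : ℝ} (hr1 : r < 1)
    (hq : (1 - r) * Fintype.card ι / 2 < q) (D : Matrix ι ι ℝ) : 0 ≤ alphaStar φ r q D := by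
  have hq' := half_lt_div_one_sub hr1 hq
  have hn : (0 : ℝ) ≤ (Fintype.card ι : ℝ) / 2 := by positivity
  have h1 := Real.Gamma_pos_of_pos (hn.trans_lt hq')
  have h2 := Real.Gamma_pos_of_pos (sub_pos.2 hq')
  have hπ := Real.pi_pos
  refine integral_nonneg fun y => mul_nonneg (hφ _) ?_
  have := zero_le_dotProduct_self y
  unfold pearsonVII
  positivity

/-- The tangent inequality at the product density, with weight `φ₁φ₂`; both sides are then evaluated
by the substitution formula. -/
theorem integrable_and_weighted_entropy_le {p p₁ p₂ : ℝ} {D : Matrix (ι ⊕ κ) (ι ⊕ κ) ℝ}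
    (hD : D.PosDef)
    (hp : (Fintype.card (ι ⊕ κ) : ℝ) / (Fintype.card (ι ⊕ κ) + 2) < p) (hp1 : p < 1)
    (hp₁ : (Fintype.card ι : ℝ) / (Fintype.card ι + 2) < p₁) (hp₁1 : p₁ < 1)
    (hp₂ : (Fintype.card κ : ℝ) / (Fintype.card κ + 2) < p₂) (hp₂1 : p₂ < 1)
    (hq₁ : (1 - p₁) * Fintype.card ι / 2 < p) (hq₂ : (1 - p₂) * Fintype.card κ / 2 < p)
    {φ₁ : (ι → ℝ) → ℝ} {φ₂ : (κ → ℝ) → ℝ} (hφ₁m : Measurable φ₁) (hφ₂m : Measurable φ₂)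
    (hφ₁ : ∀ x, 0 ≤ φ₁ x) (hφ₂ : ∀ x, 0 ≤ φ₂ x)
    (hα₁ : Integrable (alphaStarIntegrand φ₁ p₁ p D.toBlocks₁₁))
    (hα₂ : Integrable (alphaStarIntegrand φ₂ p₂ p D.toBlocks₂₂))
    (hint : Integrable (conditionIntegrand φ₁ φ₂ p p₁ p₂ D))
    (hcond : ∫ x, conditionIntegrand φ₁ φ₂ p p₁ p₂ D x ≤ 0) :
    Integrable (alphaStarIntegrand (prodWeight φ₁ φ₂) p p D) ∧
      varpiStar (Fintype.card (ι ⊕ κ)) p p * D.det ^ ((1 - p) / 2) *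
          alphaStar (prodWeight φ₁ φ₂) p p D ≤
        (varpiStar (Fintype.card ι) p₁ p * D.toBlocks₁₁.det ^ ((1 - p) / 2) *
            alphaStar φ₁ p₁ p D.toBlocks₁₁) *
          (varpiStar (Fintype.card κ) p₂ p * D.toBlocks₂₂.det ^ ((1 - p) / 2) *
            alphaStar φ₂ p₂ p D.toBlocks₂₂) := by
  have hp0 : 0 < p := lt_of_le_of_lt (by positivity) hp
  have hD₁ : D.toBlocks₁₁.PosDef := hD.submatrix Sum.inl_injective
  have hD₂ : D.toBlocks₂₂.PosDef := hD.submatrix Sum.inr_injective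
  have hg₁ (x) : 0 < renyiDensity p₁ D.toBlocks₁₁ x := renyiDensity_pos hp₁ hp₁1 hD₁ x
  have hg₂ (x) : 0 < renyiDensity p₂ D.toBlocks₂₂ x := renyiDensity_pos hp₂ hp₂1 hD₂ x
  have hqp := one_sub_mul_div_two_lt_self hp
  have hFp : (fun x => prodWeight φ₁ φ₂ x * blockProductDensity p₁ p₂ D x ^ p) =
      prodWeight (fun x => φ₁ x * renyiDensity p₁ D.toBlocks₁₁ x ^ p)
        (fun x => φ₂ x * renyiDensity p₂ D.toBlocks₂₂ x ^ p) := by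
    funext x
    rw [blockProductDensity, Real.mul_rpow (hg₁ _).le (hg₂ _).le]
    exact mul_mul_mul_comm _ _ _ _
  have hc : conditionIntegrand φ₁ φ₂ p p₁ p₂ D = fun x => prodWeight φ₁ φ₂ x *
      blockProductDensity p₁ p₂ D x ^ (p - 1) *
        (renyiDensity p D x - blockProductDensity p₁ p₂ D x) := by
    funext x
    rw [conditionIntegrand, blockProductDensity, Real.mul_rpow (hg₁ _).le (hg₂ _).le, prodWeight,
      mul_mul_mul_comm]
  rw [hc] at hint hcond
  have h := integrable_and_integral_mul_rpow_le (w := prodWeight φ₁ φ₂) (F := blockProductDensity p₁ p₂ D)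
    (G := renyiDensity p D) hp0 hp1
    (fun x => mul_nonneg (hφ₁ _) (hφ₂ _)) (fun x => mul_pos (hg₁ _) (hg₂ _))
    (fun x => renyiDensity_pos hp hp1 hD x)
    ((measurable_prodWeight hφ₁m hφ₂m).mul
      ((measurable_renyiDensity p D).pow_const p)).aestronglyMeasurable
    (by
      rw [hFp]
      exact integrable_prodWeight
        ((integrable_alphaStarIntegrand_iff hp₁ hp₁1 hq₁ hD₁ φ₁).1 hα₁)
        ((integrable_alphaStarIntegrand_iff hp₂ hp₂1 hq₂ hD₂ φ₂).1 hα₂)) hint hcond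
  rw [hFp, integral_prodWeight, integral_mul_renyiDensity_rpow hp hp1 hqp hD,
    integral_mul_renyiDensity_rpow hp₁ hp₁1 hq₁ hD₁,
    integral_mul_renyiDensity_rpow hp₂ hp₂1 hq₂ hD₂] at h
  exact ⟨(integrable_alphaStarIntegrand_iff hp hp1 hqp hD _).2 h.1, h.2⟩

end Main

theorem theorem3p2 {m₁ m₂ n₁ n₂ : ℕ}
    (B : Matrix (Fin m₁ ⊕ Fin m₂) (Fin n₁ ⊕ Fin n₂) ℝ)
    (C : Matrix (Fin n₁ ⊕ Fin n₂) (Fin n₁ ⊕ Fin n₂) ℝ) (hC : C.PosDef)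
    (hBC : (B * C * B.transpose).PosDef)
    (p p₁ p₂ : ℝ)
    (hp : ((m₁ + m₂ : ℕ) : ℝ) / ((m₁ + m₂ : ℕ) + 2) < p) (hp_lt : p < 1)
    (hp₁ : (m₁ : ℝ) / (m₁ + 2) < p₁) (hp₁_lt : p₁ < 1)
    (hp₂ : (m₂ : ℝ) / (m₂ + 2) < p₂) (hp₂_lt : p₂ < 1)
    (hpp₁ : (1 - p₁) * m₁ / 2 < p) (hpp₂ : (1 - p₂) * m₂ / 2 < p)
    (φ₁ : (Fin m₁ → ℝ) → ℝ) (φ₂ : (Fin m₂ → ℝ) → ℝ)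
    (hφ₁_meas : Measurable φ₁) (hφ₂_meas : Measurable φ₂)
    (hφ₁ : ∀ x, 0 ≤ φ₁ x) (hφ₂ : ∀ x, 0 ≤ φ₂ x)
    (hα₁ : Integrable (alphaStarIntegrand φ₁ p₁ p (B * C * B.transpose).toBlocks₁₁))
    (hα₂ : Integrable (alphaStarIntegrand φ₂ p₂ p (B * C * B.transpose).toBlocks₂₂))
    (hα₁_ne : alphaStar φ₁ p₁ p (B * C * B.transpose).toBlocks₁₁ ≠ 0)
    (hα₂_ne : alphaStar φ₂ p₂ p (B * C * B.transpose).toBlocks₂₂ ≠ 0)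
    (hint : Integrable (conditionIntegrand φ₁ φ₂ p p₁ p₂ (B * C * B.transpose)))
    (hcond : ∫ x, conditionIntegrand φ₁ φ₂ p p₁ p₂ (B * C * B.transpose) x ≤ 0) :
    Integrable (alphaStarIntegrand (prodWeight φ₁ φ₂) p p (B * C * B.transpose)) ∧
    ((B * C * B.transpose).det /
          ((B * C * B.transpose).toBlocks₁₁.det * (B * C * B.transpose).toBlocks₂₂.det)) ^ (1 - p) *
        (alphaStar (prodWeight φ₁ φ₂) p p (B * C * B.transpose) /
          (alphaStar φ₁ p₁ p (B * C * B.transpose).toBlocks₁₁ *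
            alphaStar φ₂ p₂ p (B * C * B.transpose).toBlocks₂₂)) ^ 2
      ≤ zetaConst m₁ m₂ p p₁ p₂ := by
  generalize B * C * B.transpose = D at *
  have hD₁ : D.toBlocks₁₁.PosDef := hBC.submatrix Sum.inl_injective
  have hD₂ : D.toBlocks₂₂.PosDef := hBC.submatrix Sum.inr_injective
  have hw : 0 < varpiStar (m₁ + m₂) p p :=
    varpiStar_pos hp hp_lt (one_sub_mul_div_two_lt_self hp)
  have hw₁ := varpiStar_pos hp₁ hp₁_lt hpp₁
  have hw₂ := varpiStar_pos hp₂ hp₂_lt hpp₂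
  have hα : 0 ≤ alphaStar (prodWeight φ₁ φ₂) p p D :=
    alphaStar_nonneg (fun x => mul_nonneg (hφ₁ _) (hφ₂ _)) hp_lt
      (by simpa using one_sub_mul_div_two_lt_self hp) D
  have hα₁' := (alphaStar_nonneg hφ₁ hp₁_lt (by simpa using hpp₁) D.toBlocks₁₁).lt_of_ne' hα₁_ne
  have hα₂' := (alphaStar_nonneg hφ₂ hp₂_lt (by simpa using hpp₂) D.toBlocks₂₂).lt_of_ne' hα₂_ne
  have hζ : zetaConst m₁ m₂ p p₁ p₂ ≤ 1 := by
    rw [zetaConst, div_le_one hw]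
    have := varpiStar_mul_varpiStar_le (ι := Fin m₁) (κ := Fin m₂) (p := p) (p₁ := p₁) (p₂ := p₂)
    simp only [Fintype.card_sum, Fintype.card_fin] at this
    exact this hp hp_lt hp₁ hp₁_lt hp₂ hp₂_lt hpp₁ hpp₂
  have hζ0 : 0 ≤ zetaConst m₁ m₂ p p₁ p₂ := div_nonneg (mul_pos hw₁ hw₂).le hw.le
  have h := integrable_and_weighted_entropy_le (p := p) (p₁ := p₁) (p₂ := p₂) hBC
  simp only [Fintype.card_sum, Fintype.card_fin] at h
  obtain ⟨hi, hle⟩ := h hp hp_lt hp₁ hp₁_lt hp₂ hp₂_lt hpp₁ hpp₂ hφ₁_meas hφ₂_meas hφ₁ hφ₂ hα₁ hα₂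
    hint hcond
  refine ⟨hi, ?_⟩
  have hd := hBC.det_pos
  have hd₁ := hD₁.det_pos
  have hd₂ := hD₂.det_pos
  -- `X` is the square root of the left side; the weighted entropy inequality is linear in it and
  -- gives `X ≤ ζ`.
  set X := (D.det / (D.toBlocks₁₁.det * D.toBlocks₂₂.det)) ^ ((1 - p) / 2) *
    (alphaStar (prodWeight φ₁ φ₂) p p D /
      (alphaStar φ₁ p₁ p D.toBlocks₁₁ * alphaStar φ₂ p₂ p D.toBlocks₂₂)) with hX
  have hX0 : 0 ≤ X := by positivity
  have hXζ : X ≤ zetaConst m₁ m₂ p p₁ p₂ := by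
    rw [hX, zetaConst, Real.div_rpow hd.le (by positivity), Real.mul_rpow hd₁.le hd₂.le,
      div_mul_div_comm, div_le_div_iff₀ (by positivity) hw]
    linarith
  calc _ = X ^ 2 := by
        rw [hX, mul_pow, ← Real.rpow_mul_natCast (by positivity)]
        norm_num
    _ ≤ zetaConst m₁ m₂ p p₁ p₂ ^ 2 := pow_le_pow_left₀ hX0 hXζ 2
    -- Here `ζ ≤ 1` is spent; the preceding line is the stronger bound by `ζ²`.
    _ ≤ zetaConst m₁ m₂ p p₁ p₂ := pow_le_of_le_one hζ0 hζ two_ne_zero
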